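/- Let $m\in\frac12\mathbb N$, $m>0$, and let $\varphi\in J^w_{0,m}$ be a weak Jacobi form of weight $0$ and index $m$, i.e. a holomorphic function $\varphi:\mathbb H\times\mathbb C\to\mathbb C$ with $$\varphi\Bigl(\tfrac{a\tau+b}{c\tau+d},\tfrac{z}{c\tau+d}\Bigr)=e^{2\pi i m\frac{cz^2}{c\tau+d}}\varphi(\tau,z)\quad\text{for all }\begin{pmatrix}a&b\\c&d\end{pmatrix}\in SL_2(\mathbb Z),$$ $$\varphi(\tau,z+x\tau+y)=(-1)^{2m(x+y)}e^{-2\pi i m(x^2\tau+2xz)}\varphi(\tau,z)\quad\text{for all }x,y\in\mathbb Z,$$ and with a Fourier expansion $\varphi(\tau,z)=\sum_{n\ge 0,\ l\in m+\mathbb Z}a(n,l)\,q^n\zeta^l$, where $q=e^{2\pi i\tau}$, $\zeta=e^{2\pi i z}$. For $k\in\mathbb Z$ put $$H_k=12\,q\frac{d}{dq}-\frac3m\Bigl(\zeta\frac{d}{d\zeta}\Bigr)^2-\frac{2k-1}{2}E_2(\tau),\qquad H_0^{[3]}=H_4\circ H_2\circ H_0,$$ where $E_2,E_4,E_6$ are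 the Eisenstein series of weight $2,4,6$ normalised to have constant term $1$. Suppose that $H_0(\varphi)\neq 0$ and that $\varphi$ satisfies a third-order modular differential equation $$\bigl(H_0^{[3]}+\lambda_1E_4H_0+\lambda_2E_6\bigr)(\varphi)=0,\qquad \lambda_1,\lambda_2\in\mathbb C.$$ Then the $q^0$-part of the Fourier expansion of $\varphi$ contains, up to $l\mapsto -l$, exactly two non-zero coefficients: there are $0\le l_1<l_2\le m$ such that, for every $l\in m+\mathbb Z$, $a(0,l)\ne0$ if and only if $|l|\in\{l_1,l_2\}$. Moreover $$\begin{cases}(6l_1^2-m)\,a(0,l_1)=-(6l_2^2-m)\,a(0,l_2)&\text{if } l_1\neq 0,\\ m\,a(0,0)=2(6l_2^2-m)\,a(0,l_2)&\text{if } l_1=0,\end{cases}$$ and, with $x_i=\frac3m l_i^2-\frac12$ for $i=1,2$, $$\lambda_1=-\bigl(x_1^2+x_1x_2+x_2^2+6(x_1+x_2)+8\bigr),\qquad \lambda_2=-x_1x_2(x_1+x_2+6).$$ -/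

import Mathlib

open UpperHalfPlane

noncomputable section

/-- `a` is the system of Fourier coefficients of `φ` as a weak Jacobi form of index `M / 2`:
`φ(τ, z) = ∑ a(n, l) exp(2πi(nτ + lz))` over `n ≥ 0` and half-integers `l = r / 2`, where `l` is
an integer if the index is an integer and lies in `1/2 + ℤ` otherwise.
The entry `a n r` is the coefficient `a(n, r / 2)` of `q^n ζ^(r/2)`. -/
structure HasWeakJacobiExpansion (M : ℕ) (φ : ℍ → ℂ → ℂ) (a : ℕ → ℤ → ℂ) : Prop where
  support : ∀ (n : ℕ) (r : ℤ), a n r ≠ 0 → r ≡ (M : ℤ) [ZMOD 2]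
  hasSum : ∀ (τ : ℍ) (z : ℂ),
    HasSum (fun p : ℕ × ℤ => a p.1 p.2 *
      Complex.exp (2 * Real.pi * Complex.I * ((p.1 : ℂ) * (τ : ℂ) + ((p.2 : ℂ) / 2) * z))) (φ τ z)

/-- `φ : ℍ × ℂ → ℂ` is a weak Jacobi form of weight `k ∈ ℤ` and index `m = M / 2`. -/
structure IsWeakJacobiForm (k : ℤ) (M : ℕ) (φ : ℍ → ℂ → ℂ) : Prop where
  holo : DifferentiableOn ℂ (fun p : ℂ × ℂ => φ (ofComplex p.1) p.2) {p | 0 < p.1.im}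
  modular : ∀ (g : Matrix.SpecialLinearGroup (Fin 2) ℤ) (τ : ℍ) (z : ℂ),
    φ (g • τ) (z / (((g 1 0 : ℤ) : ℂ) * (τ : ℂ) + ((g 1 1 : ℤ) : ℂ))) =
      (((g 1 0 : ℤ) : ℂ) * (τ : ℂ) + ((g 1 1 : ℤ) : ℂ)) ^ k *
        Complex.exp (2 * Real.pi * Complex.I * ((M : ℂ) / 2) *
          (((g 1 0 : ℤ) : ℂ) * z ^ 2 / (((g 1 0 : ℤ) : ℂ) * (τ : ℂ) + ((g 1 1 : ℤ) : ℂ)))) *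
        φ τ z
  elliptic : ∀ (x y : ℤ) (τ : ℍ) (z : ℂ),
    φ τ (z + (x : ℂ) * (τ : ℂ) + (y : ℂ)) =
      (-1 : ℂ) ^ ((M : ℤ) * (x + y)) *
        Complex.exp (-(2 * Real.pi * Complex.I * ((M : ℂ) / 2) *
          ((x : ℂ) ^ 2 * (τ : ℂ) + 2 * (x : ℂ) * z))) * φ τ z
  expansion : ∃ a : ℕ → ℤ → ℂ, HasWeakJacobiExpansion M φ a

/-- `q d/dq = (2πi)⁻¹ ∂/∂τ`. -/
def qDeriv (φ : ℍ → ℂ → ℂ) : ℍ → ℂ → ℂ := fun τ z =>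
  Derivative.normalizedDerivOfComplex (fun t : ℍ => φ t z) τ

/-- `ζ d/dζ = (2πi)⁻¹ ∂/∂z`. -/
def zetaDeriv (φ : ℍ → ℂ → ℂ) : ℍ → ℂ → ℂ := fun τ z =>
  (2 * Real.pi * Complex.I)⁻¹ * deriv (fun w : ℂ => φ τ w) z

/-- The renormalized heat operator `H = 12 q d/dq - (3/m) (ζ d/dζ)²` for the index `m = M / 2`. -/
def heatOp (M : ℕ) (φ : ℍ → ℂ → ℂ) : ℍ → ℂ → ℂ := fun τ z =>
  12 * qDeriv φ τ z - 3 / ((M : ℂ) / 2) * zetaDeriv (zetaDeriv φ) τ z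

/-- The modular differential operator `H_k = H - ((2k - 1)/2) E₂`, raising the weight by `2`. -/
def modHeatOp (M : ℕ) (k : ℤ) (φ : ℍ → ℂ → ℂ) : ℍ → ℂ → ℂ := fun τ z =>
  heatOp M φ τ z - (2 * (k : ℂ) - 1) / 2 * EisensteinSeries.E2 τ * φ τ z

/-- The iterate `H_k^{[n]} = H_{k+2(n-1)} ∘ ⋯ ∘ H_{k+2} ∘ H_k`. -/
def modHeatIter (M : ℕ) (k : ℤ) : ℕ → (ℍ → ℂ → ℂ) → (ℍ → ℂ → ℂ)
  | 0, φ => φ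
  | n + 1, φ => modHeatOp M (k + 2 * (n : ℤ)) (modHeatIter M k n φ)

/-- The third-order modular differential equation
`(H_k^{[3]} + lam₁ E₄ H_k + lam₂ E₆) φ = 0`. -/
def SatisfiesThirdOrderMDE (M : ℕ) (k : ℤ) (lam₁ lam₂ : ℂ) (φ : ℍ → ℂ → ℂ) : Prop :=
  ∀ (τ : ℍ) (z : ℂ),
    modHeatIter M k 3 φ τ z
      + lam₁ * ModularForm.E (k := 4) (by norm_num) τ * modHeatOp M k φ τ z
      + lam₂ * ModularForm.E (k := 6) (by norm_num) τ * φ τ z = 0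

end

/-!
The proof works with the Fourier expansion and with the Taylor expansion along `z = 0`; no theta
decomposition is needed.

Write `x(l) = (3/m) l² - 1/2`. On the monomial `ζ^l` the operators `H_0`, `H_2`, `H_4` act, modulo
`q`, by `-x`, `-(x + 2)`, `-(x + 4)`, so the coefficient of `q^0 ζ^l` in the differential equation
says that `x(l)` is a root of `x³ + 6x² + (8 + lam₁) x - lam₂` whenever `a(0, l) ≠ 0`
(`HasFourierJacobi.indicial_equation`). The three roots of this cubic have sum `-6`, whereas
`x(l) ≥ -1/2`. Hence at most two values of `|l|` occur, and when there are two, the relations between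
roots and coefficients give `lam₁` and `lam₂`.

That at least two values occur rests on an interplay of modularity and the equation. If a Jacobi
form of weight `k` has no `q^0`-part, its leading Taylor coefficient at `z = 0`, say of order `j`,
is a cusp form of weight `k + j`, so `k + j ≥ 12` (`HasFourierJacobi.vanishesToOrder_of_modular`).
On the other hand, an equation of order `d` in the heat operator has leading term `∂_z^{2d}`; a
solution vanishing to order `2d` along `z = 0` is zero (`HasFourierJacobi.eq_zero_of_thirdOrder`,
`HasFourierJacobi.eq_zero_of_secondOrder`). Applied to `φ` with `d = 3` this shows that the
`q^0`-part is nonzero.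

The function `ψ = H_0 φ` has weight `2` (`isJacobiModular_modHeatOp`), and there are no modular
forms of weight `2`, so `ψ(τ, 0) = 0`; its constant term is the relation `∑ x(l) a(0, l) = 0`,
which is the stated linear relation. If only one value of `|l|` occurred, it would give
`x(l) = 0`, hence `lam₂ = 0`, and `ψ` would have no `q^0`-part and satisfy `(H_4 H_2 + lam₁ E₄) ψ = 0`;
the argument above with `d = 2` gives `ψ = 0`, contrary to assumption.

Finally `|l| ≤ m` follows from evenness and the elliptic transformation law
(`HasFourierJacobi.coeff_eq_zero_of_lt_neg_index`).
-/

noncomputable section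

open scoped MatrixGroups ModularForm Manifold

/-! ### Fourier–Jacobi expansions and termwise differentiation -/

/-- The monomial `q^n ζ^(r/2)` attached to `p = (n, r)`, with `q = exp(2πit)` and
`ζ = exp(2πiz)`. -/
def fourierTerm (p : ℕ × ℤ) (t z : ℂ) : ℂ :=
  Complex.exp (2 * Real.pi * Complex.I * ((p.1 : ℂ) * t + ((p.2 : ℂ) / 2) * z))

/-- `φ(τ, z) = ∑ a(n, r) q^n ζ^(r/2)` over `n ≥ 0` and `r ∈ ℤ`, absolutely convergent everywhere.
No transformation law and no parity condition on `r` is imposed, so that the class is stable under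
differentiation and under multiplication by `q`-series. -/
def HasFourierJacobi (a : ℕ × ℤ → ℂ) (φ : ℍ → ℂ → ℂ) : Prop :=
  ∀ (τ : ℍ) (z : ℂ), HasSum (fun p => a p * fourierTerm p τ z) (φ τ z)

/-- An upper bound for `q^n ζ^(r/2)`, uniform on `y ≤ Im t`, `|Im z| ≤ R`. -/
def majorant (y R : ℝ) (p : ℕ × ℤ) : ℝ :=
  Real.exp (-(2 * Real.pi * p.1 * y)) * Real.exp (Real.pi * |(p.2 : ℝ)| * R)

lemma norm_fourierTerm (p : ℕ × ℤ) (t z : ℂ) :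
    ‖fourierTerm p t z‖ = Real.exp (-(2 * Real.pi * p.1 * t.im)) *
      Real.exp (-(Real.pi * p.2 * z.im)) := by
  rw [fourierTerm, Complex.norm_exp, ← Real.exp_add]
  congr 1
  have : (2 * Real.pi * Complex.I * ((p.1 : ℂ) * t + ((p.2 : ℂ) / 2) * z)) =
    ((2 * Real.pi : ℝ) : ℂ) *
      (Complex.I * (((p.1 : ℝ) : ℂ) * t + (((p.2 : ℝ) / 2 : ℝ) : ℂ) * z)) := by
    push_cast; ring
  rw [this, Complex.re_ofReal_mul, Complex.I_mul_re, Complex.add_im, Complex.im_ofReal_mul,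
    Complex.im_ofReal_mul]
  ring

lemma norm_fourierTerm_le (p : ℕ × ℤ) {t z : ℂ} {y R : ℝ} (ht : y ≤ t.im) (hz : |z.im| ≤ R) :
    ‖fourierTerm p t z‖ ≤ majorant y R p := by
  rw [norm_fourierTerm, majorant]
  have hpi := Real.pi_pos
  have h1 : -((p.2 : ℝ) * z.im) ≤ |(p.2 : ℝ)| * R := by
    calc -((p.2 : ℝ) * z.im) ≤ |(p.2 : ℝ) * z.im| := neg_le_abs _
      _ = |(p.2 : ℝ)| * |z.im| := abs_mul _ _
      _ ≤ _ := by gcongr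
  gcongr
  nlinarith

lemma hasDerivAt_fourierTerm_right (p : ℕ × ℤ) (t z : ℂ) :
    HasDerivAt (fun w => fourierTerm p t w)
      (2 * Real.pi * Complex.I * ((p.2 : ℂ) / 2) * fourierTerm p t z) z := by
  have h := ((((hasDerivAt_id z).const_mul ((p.2 : ℂ) / 2)).const_add ((p.1 : ℂ) * t)).const_mul
    (2 * Real.pi * Complex.I)).cexp
  simp only [id] at h
  convert! h using 1
  rw [fourierTerm]; ring

lemma hasDerivAt_fourierTerm_left (p : ℕ × ℤ) (t z : ℂ) :
    HasDerivAt (fun w => fourierTerm p w z)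
      (2 * Real.pi * Complex.I * (p.1 : ℂ) * fourierTerm p t z) t := by
  have h := ((((hasDerivAt_id t).const_mul (p.1 : ℂ)).add_const (((p.2 : ℂ) / 2) * z)).const_mul
    (2 * Real.pi * Complex.I)).cexp
  simp only [id] at h
  convert! h using 1
  rw [fourierTerm]; ring

lemma isOpen_abs_im_lt (R : ℝ) : IsOpen {w : ℂ | |w.im| < R} :=
  isOpen_lt (Complex.continuous_im.abs) continuous_const

lemma isOpen_lt_im (y : ℝ) : IsOpen {w : ℂ | y < w.im} :=
  isOpen_lt continuous_const Complex.continuous_im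

namespace HasFourierJacobi

variable {a b : ℕ × ℤ → ℂ} {φ ψ : ℍ → ℂ → ℂ}

/-- The majorants are summable: each is at most the sum of the moduli of its monomial at
`τ = iy`, `z = ± iR`. Together with `norm_le` this permits termwise differentiation. -/
lemma summable_norm (h : HasFourierJacobi a φ) {y : ℝ} (hy : 0 < y) (R : ℝ) :
    Summable (fun p => ‖a p‖ * majorant y R p) := by
  have h1 := (h ⟨y * Complex.I, by simpa using hy⟩ (R * Complex.I)).summable.norm
  have h2 := (h ⟨y * Complex.I, by simpa using hy⟩ (-(R * Complex.I))).summable.norm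
  refine Summable.of_nonneg_of_le (fun p => ?_) (fun p => ?_) (h1.add h2)
  · unfold majorant; positivity
  · rw [norm_mul, norm_mul, norm_fourierTerm, norm_fourierTerm, majorant, ← mul_add, ← mul_add]
    simp only [Complex.mul_im, Complex.ofReal_re, Complex.I_im, mul_one, Complex.ofReal_im,
      Complex.I_re, mul_zero, add_zero, Complex.neg_im]
    gcongr
    rcases abs_cases (p.2 : ℝ) with ⟨h, -⟩ | ⟨h, -⟩ <;> rw [h]
    · have : Real.pi * (p.2 : ℝ) * R = -(Real.pi * p.2 * -R) := by ring
      rw [this]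
      exact le_add_of_nonneg_left (Real.exp_pos _).le
    · have : Real.pi * -(p.2 : ℝ) * R = -(Real.pi * p.2 * R) := by ring
      rw [this]
      exact le_add_of_nonneg_right (Real.exp_pos _).le

lemma norm_le (p : ℕ × ℤ) {t z : ℂ} {y R : ℝ} (ht : y ≤ t.im) (hz : |z.im| ≤ R) :
    ‖a p * fourierTerm p t z‖ ≤ ‖a p‖ * majorant y R p := by
  rw [norm_mul]
  gcongr
  exact norm_fourierTerm_le p ht hz

lemma eq_tsum (h : HasFourierJacobi a φ) (τ : ℍ) (z : ℂ) :
    φ τ z = ∑' p, a p * fourierTerm p τ z := (h τ z).tsum_eq.symm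

lemma unique (h : HasFourierJacobi a φ) (h' : HasFourierJacobi a ψ) : φ = ψ := by
  funext τ z
  exact (h τ z).unique (h' τ z)

lemma add (h : HasFourierJacobi a φ) (h' : HasFourierJacobi b ψ) :
    HasFourierJacobi (fun p => a p + b p) (fun τ z => φ τ z + ψ τ z) := fun τ z => by
  simpa only [add_mul] using (h τ z).add (h' τ z)

lemma const_mul (c : ℂ) (h : HasFourierJacobi a φ) :
    HasFourierJacobi (fun p => c * a p) (fun τ z => c * φ τ z) := fun τ z => by
  simpa only [mul_assoc] using (h τ z).mul_left c

lemma differentiable (h : HasFourierJacobi a φ) (τ : ℍ) : Differentiable ℂ (φ τ) := by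
  intro z
  have := Complex.differentiableOn_tsum_of_summable_norm (F := fun p w => a p * fourierTerm p τ w)
    (h.summable_norm τ.im_pos (|z.im| + 1))
    (fun p w _ => ((hasDerivAt_fourierTerm_right p τ w).const_mul
      (a p)).differentiableAt.differentiableWithinAt)
    (isOpen_abs_im_lt _) (fun p w hw => norm_le p (by simp) (le_of_lt hw))
  have h2 := this.differentiableAt (x := z) ((isOpen_abs_im_lt _).mem_nhds (by simp))
  simpa only [← h.eq_tsum] using h2

lemma zetaDeriv (h : HasFourierJacobi a φ) :
    HasFourierJacobi (fun p => (p.2 : ℂ) / 2 * a p) (zetaDeriv φ) := by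
  intro τ z
  have := Complex.hasSum_deriv_of_summable_norm (F := fun p w => a p * fourierTerm p τ w) (z := z)
    (h.summable_norm τ.im_pos (|z.im| + 1))
    (fun p w _ => ((hasDerivAt_fourierTerm_right p τ w).const_mul
      (a p)).differentiableAt.differentiableWithinAt)
    (isOpen_abs_im_lt _) (fun p w hw => norm_le p (by simp) (le_of_lt hw)) (by simp)
  simp only [← h.eq_tsum] at this
  convert! this.mul_left (2 * Real.pi * Complex.I)⁻¹ using 1
  funext p
  rw [((hasDerivAt_fourierTerm_right p τ z).const_mul (a p)).deriv]
  have := Complex.two_pi_I_ne_zero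
  field_simp

lemma differentiableOn (h : HasFourierJacobi a φ) (z : ℂ) :
    DifferentiableOn ℂ (fun t => φ (ofComplex t) z) {t | 0 < t.im} := by
  intro t ht
  have ht' : 0 < t.im := ht
  have := Complex.differentiableOn_tsum_of_summable_norm (F := fun p w => a p * fourierTerm p w z)
    (h.summable_norm (half_pos ht') |z.im|)
    (fun p w _ => ((hasDerivAt_fourierTerm_left p w z).const_mul
      (a p)).differentiableAt.differentiableWithinAt)
    (isOpen_lt_im _) (fun p w hw => norm_le p (le_of_lt hw) le_rfl)
  have hm : {w : ℂ | t.im / 2 < w.im} ∈ nhds t := (isOpen_lt_im _).mem_nhds (by simpa using ht')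
  have h2 := this.differentiableAt (x := t) hm
  refine (h2.congr_of_eventuallyEq ?_).differentiableWithinAt
  filter_upwards [hm] with w hw
  have hw' : 0 < w.im := (half_pos ht').trans hw
  rw [h.eq_tsum, ofComplex_apply_of_im_pos hw']

lemma qDeriv (h : HasFourierJacobi a φ) :
    HasFourierJacobi (fun p => (p.1 : ℂ) * a p) (qDeriv φ) := by
  intro τ z
  have hm : {w : ℂ | τ.im / 2 < w.im} ∈ nhds (τ : ℂ) :=
    (isOpen_lt_im _).mem_nhds (by simpa using τ.im_pos)
  have := Complex.hasSum_deriv_of_summable_norm (F := fun p w => a p * fourierTerm p w z) (z := τ)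
    (h.summable_norm (half_pos τ.im_pos) |z.im|)
    (fun p w _ => ((hasDerivAt_fourierTerm_left p w z).const_mul
      (a p)).differentiableAt.differentiableWithinAt)
    (isOpen_lt_im _) (fun p w hw => norm_le p (le_of_lt hw) le_rfl) (mem_of_mem_nhds hm)
  have he : (fun w => ∑' p, a p * fourierTerm p w z) =ᶠ[nhds (τ : ℂ)]
      ((fun t : ℍ => φ t z) ∘ ofComplex) := by
    filter_upwards [hm] with w hw
    have hw' : 0 < w.im := (half_pos τ.im_pos).trans hw
    rw [Function.comp, h.eq_tsum, ofComplex_apply_of_im_pos hw']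
  rw [he.deriv_eq] at this
  convert! this.mul_left (2 * Real.pi * Complex.I)⁻¹ using 1
  funext p
  rw [((hasDerivAt_fourierTerm_left p τ z).const_mul (a p)).deriv]
  have := Complex.two_pi_I_ne_zero
  field_simp

lemma zetaDeriv_qDeriv (h : HasFourierJacobi a φ) :
    _root_.zetaDeriv (_root_.qDeriv φ) = _root_.qDeriv (_root_.zetaDeriv φ) := by
  refine h.qDeriv.zetaDeriv.unique ?_
  convert! h.zetaDeriv.qDeriv using 2 with p
  ring

end HasFourierJacobi

/-! ### Multiplication by q-series and the modified heat operators -/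

/-- `f(τ) = ∑ c(n) q^n` on the upper half plane. -/
def HasQExpansion (c : ℕ → ℂ) (f : ℍ → ℂ) : Prop :=
  ∀ τ : ℍ, HasSum (fun n => c n • Function.Periodic.qParam 1 (τ : ℂ) ^ n) (f τ)

lemma hasQExpansion_E2 :
    ∃ c, HasQExpansion c EisensteinSeries.E2 ∧ c 0 = 1 :=
  ⟨_, fun τ => by
    simpa only [Function.Periodic.qParam, Complex.ofReal_one, div_one] using
      EisensteinSeries.hasSum_qExpansion_E2 τ, if_pos rfl⟩

lemma hasQExpansion_E {k : ℕ} (hk : 3 ≤ k) (hk2 : Even k) :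
    ∃ c, HasQExpansion c (ModularForm.E hk) ∧ c 0 = 1 :=
  ⟨_, fun τ => ModularForm.hasSum_qExpansion (ModularForm.E hk) one_pos
      one_mem_strictPeriods_SL τ, EisensteinSeries.E_qExpansion_coeff_zero hk hk2⟩

lemma hasSum_prod_mul {ι κ : Type*} {u : ι → ℂ} {v : κ → ℂ} {s t : ℂ} (hu : HasSum u s)
    (hv : HasSum v t) : HasSum (fun x : ι × κ => u x.1 * v x.2) (s * t) :=
  hu.mul hv (summable_mul_of_summable_norm hu.summable.norm hv.summable.norm)

/-- The reindexing `(k, (n, r)) ↦ (k + n, r)` behind the product of a `q`-series with a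
Fourier–Jacobi series. -/
def sigmaAntidiagonalProdEquiv :
    (Σ p : ℕ × ℤ, Finset.HasAntidiagonal.antidiagonal p.1) ≃ ℕ × (ℕ × ℤ) where
  toFun x := (x.2.1.1, (x.2.1.2, x.1.2))
  invFun y := ⟨(y.1 + y.2.1, y.2.2), ⟨(y.1, y.2.1), by simp⟩⟩
  left_inv := by
    rintro ⟨⟨n, r⟩, ⟨⟨i, j⟩, h⟩⟩
    obtain rfl : i + j = n := by simpa using h
    rfl
  right_inv _ := rfl

lemma qParam_pow_mul_fourierTerm (i j : ℕ) (r : ℤ) (t z : ℂ) :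
    Function.Periodic.qParam 1 t ^ i * fourierTerm (j, r) t z = fourierTerm (i + j, r) t z := by
  rw [Function.Periodic.qParam, fourierTerm, fourierTerm, ← Complex.exp_nat_mul, ← Complex.exp_add]
  congr 1
  push_cast; ring

lemma fourierTerm_eq (n : ℕ) (r : ℤ) (t z : ℂ) :
    fourierTerm (n, r) t z = Function.Periodic.qParam 1 t ^ n * fourierTerm (0, r) 0 z := by
  have h4 := qParam_pow_mul_fourierTerm n 0 r t z
  rw [add_zero] at h4
  rw [← h4]
  congr 1
  simp [fourierTerm]

namespace HasFourierJacobi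

variable {a b : ℕ × ℤ → ℂ} {φ ψ : ℍ → ℂ → ℂ} {c : ℕ → ℂ} {f : ℍ → ℂ}

lemma qMul (h : HasFourierJacobi a φ) (hf : HasQExpansion c f) :
    HasFourierJacobi (fun p => ∑ x ∈ Finset.HasAntidiagonal.antidiagonal p.1, c x.1 * a (x.2, p.2))
      (fun τ z => f τ * φ τ z) := by
  intro τ z
  have hu : HasSum (fun n => c n * Function.Periodic.qParam 1 (τ : ℂ) ^ n) (f τ) := hf τ
  have h1 := hasSum_prod_mul hu (h τ z)
  rw [← sigmaAntidiagonalProdEquiv.hasSum_iff] at h1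
  refine h1.sigma fun p => ?_
  have h2 : (∑ x ∈ Finset.HasAntidiagonal.antidiagonal p.1, c x.1 * a (x.2, p.2)) *
      fourierTerm p τ z = ∑ x : Finset.HasAntidiagonal.antidiagonal p.1,
        c x.1.1 * a (x.1.2, p.2) * fourierTerm p τ z := by
    rw [Finset.sum_mul, ← Finset.sum_coe_sort]
  rw [h2]
  convert! hasSum_fintype _ using 2 with x
  obtain ⟨⟨i, j⟩, hx⟩ := x
  have hx' : i + j = p.1 := by simpa using hx
  have h3 := qParam_pow_mul_fourierTerm i j p.2 τ z
  rw [hx', Prod.mk.eta] at h3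
  rw [← h3]
  simp only [sigmaAntidiagonalProdEquiv, Function.comp, Equiv.coe_fn_mk]
  ring

lemma heatOp (h : HasFourierJacobi a φ) (M : ℕ) :
    HasFourierJacobi (fun p => 12 * ((p.1 : ℂ) * a p) +
      -(3 / ((M : ℂ) / 2)) * ((p.2 : ℂ) / 2 * ((p.2 : ℂ) / 2 * a p))) (heatOp M φ) := by
  convert! (h.qDeriv.const_mul 12).add
    (h.zetaDeriv.zetaDeriv.const_mul (-(3 / ((M : ℂ) / 2)))) using 1
  funext τ z
  rw [_root_.heatOp]; ring

/-- On the part constant in `q`, `H_k` acts diagonally, because `E₂` has constant term `1`. -/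
lemma modHeatOp (h : HasFourierJacobi a φ) (M : ℕ) (k : ℤ) :
    ∃ b, HasFourierJacobi b (modHeatOp M k φ) ∧
      ∀ r : ℤ, b (0, r) =
        -(3 / ((M : ℂ) / 2) * ((r : ℂ) / 2) ^ 2 + (2 * (k : ℂ) - 1) / 2) * a (0, r) := by
  obtain ⟨c, hc, hc0⟩ := hasQExpansion_E2
  have h2 := (h.heatOp M).add ((h.qMul hc).const_mul (-((2 * (k : ℂ) - 1) / 2)))
  have e : _root_.modHeatOp M k φ = fun τ z => _root_.heatOp M φ τ z +
      -((2 * (k : ℂ) - 1) / 2) * (EisensteinSeries.E2 τ * φ τ z) := by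
    funext τ z
    rw [_root_.modHeatOp]; ring
  refine ⟨_, e ▸ h2, ?_⟩
  · intro r
    simp [hc0]
    ring

end HasFourierJacobi

lemma zetaDeriv_add {φ ψ : ℍ → ℂ → ℂ} (h : ∀ τ, Differentiable ℂ (φ τ))
    (h' : ∀ τ, Differentiable ℂ (ψ τ)) :
    zetaDeriv (fun τ z => φ τ z + ψ τ z) = fun τ z => zetaDeriv φ τ z + zetaDeriv ψ τ z := by
  funext τ z
  simp only [zetaDeriv]
  rw [deriv_fun_add (h τ z) (h' τ z), mul_add]

lemma zetaDeriv_mul (f : ℍ → ℂ) (φ : ℍ → ℂ → ℂ) :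
    zetaDeriv (fun τ z => f τ * φ τ z) = fun τ z => f τ * zetaDeriv φ τ z := by
  funext τ z
  simp only [zetaDeriv]
  rw [deriv_const_mul_field]
  ring

lemma qDeriv_eq_zero_of_forall (φ : ℍ → ℂ → ℂ) (h : ∀ τ, φ τ 0 = 0) (τ : ℍ) : qDeriv φ τ 0 = 0 := by
  simp only [qDeriv, h]
  exact congrFun (Derivative.normalizedDerivOfComplex_const 0) τ

namespace HasFourierJacobi

variable {a b : ℕ × ℤ → ℂ} {φ ψ : ℍ → ℂ → ℂ} {c : ℕ → ℂ} {f : ℍ → ℂ}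

/-- The coefficients of `H_k` do not depend on `z`. -/
lemma zetaDeriv_modHeatOp (h : HasFourierJacobi a φ) (M : ℕ) (k : ℤ) :
    _root_.zetaDeriv (_root_.modHeatOp M k φ) = _root_.modHeatOp M k (_root_.zetaDeriv φ) := by
  obtain ⟨c, hc, -⟩ := hasQExpansion_E2
  have e (χ : ℍ → ℂ → ℂ) : _root_.modHeatOp M k χ = fun τ z =>
      (fun _ => 12 : ℍ → ℂ) τ * _root_.qDeriv χ τ z +
      ((fun _ => -(3 / ((M : ℂ) / 2)) : ℍ → ℂ) τ * _root_.zetaDeriv (_root_.zetaDeriv χ) τ z +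
      (fun τ => -((2 * (k : ℂ) - 1) / 2 * EisensteinSeries.E2 τ) : ℍ → ℂ) τ * χ τ z) := by
    funext τ z
    simp only [_root_.modHeatOp, _root_.heatOp]; ring
  rw [e, e, zetaDeriv_add, zetaDeriv_add, zetaDeriv_mul, zetaDeriv_mul, zetaDeriv_mul,
    h.zetaDeriv_qDeriv]
  · exact fun τ => (h.zetaDeriv.zetaDeriv.differentiable τ).const_mul _
  · exact fun τ => (h.differentiable τ).const_mul _
  · exact fun τ => (h.qDeriv.differentiable τ).const_mul _
  · exact fun τ => ((h.zetaDeriv.zetaDeriv.differentiable τ).const_mul _).add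
      ((h.differentiable τ).const_mul _)

lemma iterate_zetaDeriv (h : HasFourierJacobi a φ) (j : ℕ) :
    HasFourierJacobi (fun p => ((p.2 : ℂ) / 2) ^ j * a p) (_root_.zetaDeriv^[j] φ) := by
  induction j with
  | zero => simpa using h
  | succ j ih =>
    rw [Function.iterate_succ_apply']
    convert! ih.zetaDeriv using 1
    funext p
    ring

lemma iterate_zetaDeriv_modHeatOp (h : HasFourierJacobi a φ) (M : ℕ) (k : ℤ) (j : ℕ) :
    _root_.zetaDeriv^[j] (_root_.modHeatOp M k φ) =
      _root_.modHeatOp M k (_root_.zetaDeriv^[j] φ) := by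
  induction j with
  | zero => rfl
  | succ j ih =>
    rw [Function.iterate_succ_apply', ih, (h.iterate_zetaDeriv j).zetaDeriv_modHeatOp,
      Function.iterate_succ_apply']

end HasFourierJacobi

/-- `φ` vanishes to order at least `N` along `z = 0`. -/
def VanishesToOrder (N : ℕ) (φ : ℍ → ℂ → ℂ) : Prop :=
  ∀ i < N, ∀ τ : ℍ, (zetaDeriv^[i] φ) τ 0 = 0

lemma VanishesToOrder.mono {N N' : ℕ} {φ : ℍ → ℂ → ℂ} (h : VanishesToOrder N φ) (hN : N' ≤ N) :
    VanishesToOrder N' φ := fun i hi => h i (hi.trans_le hN)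

lemma iterate_zetaDeriv_mul (f : ℍ → ℂ) (φ : ℍ → ℂ → ℂ) (j : ℕ) :
    zetaDeriv^[j] (fun τ z => f τ * φ τ z) = fun τ z => f τ * (zetaDeriv^[j] φ) τ z := by
  induction j with
  | zero => rfl
  | succ j ih => rw [Function.iterate_succ_apply', ih, zetaDeriv_mul, Function.iterate_succ_apply']

lemma iterate_zetaDeriv_zero (j : ℕ) :
    zetaDeriv^[j] (fun _ _ => 0) = fun _ _ => 0 := by
  simpa using iterate_zetaDeriv_mul (fun _ => 0) (fun _ _ => 0) j

lemma VanishesToOrder.qMul {N : ℕ} {φ : ℍ → ℂ → ℂ} (h : VanishesToOrder N φ) (f : ℍ → ℂ) :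
    VanishesToOrder N (fun τ z => f τ * φ τ z) := fun i hi τ => by
  rw [iterate_zetaDeriv_mul]
  simp [h i hi τ]

namespace HasFourierJacobi

variable {a b : ℕ × ℤ → ℂ} {φ ψ : ℍ → ℂ → ℂ} {c : ℕ → ℂ} {f : ℍ → ℂ}

lemma iterate_zetaDeriv_add (h : HasFourierJacobi a φ) (h' : HasFourierJacobi b ψ) (j : ℕ) :
    _root_.zetaDeriv^[j] (fun τ z => φ τ z + ψ τ z) =
      fun τ z => (_root_.zetaDeriv^[j] φ) τ z + (_root_.zetaDeriv^[j] ψ) τ z := by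
  induction j with
  | zero => rfl
  | succ j ih =>
    rw [Function.iterate_succ_apply', ih, zetaDeriv_add (h.iterate_zetaDeriv j).differentiable
      (h'.iterate_zetaDeriv j).differentiable]
    simp only [Function.iterate_succ_apply']

/-- On functions vanishing to order `N + 1` only the second `z`-derivative contributes to the
`N`-th Taylor coefficient of `H_k φ`. -/
lemma iterate_zetaDeriv_modHeatOp_zero (h : HasFourierJacobi a φ) {N : ℕ}
    (hv : VanishesToOrder (N + 1) φ) (M : ℕ) (k : ℤ) (τ : ℍ) :
    (_root_.zetaDeriv^[N] (_root_.modHeatOp M k φ)) τ 0 =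
      -(3 / ((M : ℂ) / 2)) * (_root_.zetaDeriv^[N + 2] φ) τ 0 := by
  rw [h.iterate_zetaDeriv_modHeatOp, _root_.modHeatOp, _root_.heatOp,
    qDeriv_eq_zero_of_forall _ (hv N (Nat.lt_succ_self N)), hv N (Nat.lt_succ_self N) τ,
    Function.iterate_succ_apply', Function.iterate_succ_apply']
  ring

lemma vanishesToOrder_modHeatOp (h : HasFourierJacobi a φ) {N : ℕ}
    (hv : VanishesToOrder (N + 2) φ) (M : ℕ) (k : ℤ) :
    VanishesToOrder N (_root_.modHeatOp M k φ) := fun i hi τ => by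
  rw [h.iterate_zetaDeriv_modHeatOp_zero (hv.mono (by omega)), hv (i + 2) (by omega), mul_zero]

lemma iteratedDeriv_eq (φ : ℍ → ℂ → ℂ) (j : ℕ) (τ : ℍ) (z : ℂ) :
    iteratedDeriv j (φ τ) z = (2 * Real.pi * Complex.I) ^ j * (_root_.zetaDeriv^[j] φ) τ z := by
  induction j generalizing z with
  | zero => simp
  | succ j ih =>
    rw [iteratedDeriv_succ, funext ih, deriv_const_mul_field, Function.iterate_succ_apply',
      _root_.zetaDeriv, pow_succ, mul_assoc _ (2 * (Real.pi : ℂ) * Complex.I),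
      mul_inv_cancel_left₀ Complex.two_pi_I_ne_zero]

lemma eq_zero_of_vanishes (h : HasFourierJacobi a φ) (hv : ∀ N, VanishesToOrder N φ) :
    ∀ τ z, φ τ z = 0 := by
  intro τ z
  have := Complex.taylorSeries_eq_of_entire (h.differentiable τ) 0 z
  rw [← this]
  simp [iteratedDeriv_eq, hv _ _ (Nat.lt_succ_self _)]

/-- If `(H_{k₁} H_{k₂} + f) φ = 0` and `φ` vanishes to order `4` along `z = 0`, then `φ = 0`: at
order `N - 4` the equation reads `(3/m)² ∂^N φ = 0` as soon as all lower derivatives vanish. -/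
lemma eq_zero_of_secondOrder (h : HasFourierJacobi a φ) {M : ℕ} (hM : 0 < M) {k₁ k₂ : ℤ} {f : ℍ → ℂ}
    (hE : ∀ τ z, _root_.modHeatOp M k₁ (_root_.modHeatOp M k₂ φ) τ z + f τ * φ τ z = 0)
    (hf : HasQExpansion c f)
    (hv : VanishesToOrder 4 φ) : ∀ τ z, φ τ z = 0 := by
  have hM' : (M : ℂ) ≠ 0 := by exact_mod_cast hM.ne'
  obtain ⟨b₁, h₁, -⟩ := h.modHeatOp M k₂
  obtain ⟨b₂, h₂, -⟩ := h₁.modHeatOp M k₁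
  have key (N : ℕ) : VanishesToOrder (N + 4) φ := by
    induction N with
    | zero => exact hv
    | succ N ih =>
      intro i hi τ
      rcases Nat.lt_succ_iff_lt_or_eq.mp hi with hi | rfl
      · exact ih i hi τ
      have h0 : _root_.zetaDeriv^[N] (fun τ z => _root_.modHeatOp M k₁ (_root_.modHeatOp M k₂ φ) τ z
          + f τ * φ τ z) τ 0 = 0 := by
        rw [show (fun τ z => _root_.modHeatOp M k₁ (_root_.modHeatOp M k₂ φ) τ z + f τ * φ τ z) =
          fun _ _ => 0 by funext τ z; exact hE τ z, iterate_zetaDeriv_zero]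
      rw [h₂.iterate_zetaDeriv_add (h.qMul hf)] at h0
      beta_reduce at h0
      rw [ih.qMul f N (by omega),
        h₁.iterate_zetaDeriv_modHeatOp_zero
          ((h.vanishesToOrder_modHeatOp ih M k₂).mono (by omega)),
        h.iterate_zetaDeriv_modHeatOp_zero (N := N + 2) (ih.mono (by omega))] at h0
      simpa [hM'] using h0
  exact h.eq_zero_of_vanishes fun N => (key N).mono (by omega)

/-- The analogue of `eq_zero_of_secondOrder` for three factors. -/
lemma eq_zero_of_thirdOrder (h : HasFourierJacobi a φ) {M : ℕ} (hM : 0 < M) {k₁ k₂ k₃ k₄ : ℤ}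
    {f g : ℍ → ℂ} {d : ℕ → ℂ}
    (hE : ∀ τ z, _root_.modHeatOp M k₁ (_root_.modHeatOp M k₂ (_root_.modHeatOp M k₃ φ)) τ z +
      f τ * _root_.modHeatOp M k₄ φ τ z + g τ * φ τ z = 0)
    (hf : HasQExpansion c f) (hg : HasQExpansion d g)
    (hv : VanishesToOrder 6 φ) : ∀ τ z, φ τ z = 0 := by
  have hM' : (M : ℂ) ≠ 0 := by exact_mod_cast hM.ne'
  obtain ⟨b₁, h₁, -⟩ := h.modHeatOp M k₃
  obtain ⟨b₂, h₂, -⟩ := h₁.modHeatOp M k₂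
  obtain ⟨b₃, h₃, -⟩ := h₂.modHeatOp M k₁
  obtain ⟨b₄, h₄, -⟩ := h.modHeatOp M k₄
  have key (N : ℕ) : VanishesToOrder (N + 6) φ := by
    induction N with
    | zero => exact hv
    | succ N ih =>
      intro i hi τ
      rcases Nat.lt_succ_iff_lt_or_eq.mp hi with hi | rfl
      · exact ih i hi τ
      have h0 : _root_.zetaDeriv^[N] (fun τ z => _root_.modHeatOp M k₁ (_root_.modHeatOp M k₂
          (_root_.modHeatOp M k₃ φ)) τ z + f τ * _root_.modHeatOp M k₄ φ τ z +
          g τ * φ τ z) τ 0 = 0 := by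
        rw [show (fun τ z => _root_.modHeatOp M k₁ (_root_.modHeatOp M k₂
          (_root_.modHeatOp M k₃ φ)) τ z + f τ * _root_.modHeatOp M k₄ φ τ z + g τ * φ τ z) =
          fun _ _ => 0 by funext τ z; exact hE τ z, iterate_zetaDeriv_zero]
      rw [(h₃.add (h₄.qMul hf)).iterate_zetaDeriv_add (h.qMul hg),
        h₃.iterate_zetaDeriv_add (h₄.qMul hf)] at h0
      beta_reduce at h0
      rw [ih.qMul g N (by omega),
        (h.vanishesToOrder_modHeatOp ih M k₄).qMul f N (by omega),
        h₂.iterate_zetaDeriv_modHeatOp_zero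
          ((h₁.vanishesToOrder_modHeatOp
            (h.vanishesToOrder_modHeatOp ih M k₃) M k₂).mono (by omega)),
        h₁.iterate_zetaDeriv_modHeatOp_zero (N := N + 2)
          ((h.vanishesToOrder_modHeatOp ih M k₃).mono (by omega)),
        h.iterate_zetaDeriv_modHeatOp_zero (N := N + 4) (ih.mono (by omega))] at h0
      simpa [hM'] using h0
  exact h.eq_zero_of_vanishes fun N => (key N).mono (by omega)

end HasFourierJacobi

/-! ### Taylor coefficients along the zero section as modular forms of level one -/

namespace HasQExpansion
variable {c : ℕ → ℂ} {f : ℍ → ℂ}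

/-- A holomorphic function with a `q`-expansion that is invariant under the weight `k` slash
action of `SL(2, ℤ)`, as a modular form; boundedness at the cusp comes from the expansion. -/
def toModularForm (hc : HasQExpansion c f) (hf : MDiff f) {k : ℤ}
    (hs : ∀ γ : SL(2, ℤ), f ∣[k] γ = f) : ModularForm 𝒮ℒ k where
  toFun := f
  slash_action_eq' _ hA := by
    obtain ⟨A, rfl⟩ := hA
    exact hs A
  holo' := hf
  bdd_at_cusps' hx := by
    rw [Subgroup.IsArithmetic.isCusp_iff_isCusp_SL2Z] at hx
    rw [OnePoint.isBoundedAt_iff_forall_SL2Z hx]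
    intro γ _
    rw [hs γ]
    exact isBoundedAtImInfty_of_hasSum_qExpansion one_pos hc

lemma eq_zero_of_weight_lt_twelve (hc : HasQExpansion c f) (hf : MDiff f) {k : ℤ}
    (hs : ∀ γ : SL(2, ℤ), f ∣[k] γ = f) (hk : k < 12) (h0 : c 0 = 0) (τ : ℍ) : f τ = 0 := by
  have hq : (qExpansion 1 (hc.toModularForm hf hs)).coeff 0 = 0 := by
    rw [← h0]
    exact (ModularFormClass.qExpansion_coeff_unique one_pos one_mem_strictPeriods_SL
      (f := hc.toModularForm hf hs) hc 0).symm
  have := rank_zero_iff_forall_zero.mp (CuspForm.rank_eq_zero_of_weight_lt_twelve hk)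
    (ModularForm.toCuspForm _ hq)
  exact DFunLike.congr_fun this τ

lemma eq_zero_of_weight_two (hc : HasQExpansion c f) (hf : MDiff f)
    (hs : ∀ γ : SL(2, ℤ), f ∣[(2 : ℤ)] γ = f) (τ : ℍ) : f τ = 0 :=
  DFunLike.congr_fun (rank_zero_iff_forall_zero.mp ModularForm.levelOne_weight_two_rank_zero
    (hc.toModularForm hf hs)) τ

lemma coeff_eq_zero (hc : HasQExpansion c f) (h : ∀ τ, f τ = 0) (n : ℕ) : c n = 0 := by
  obtain rfl : f = 0 := funext h
  have hc' : HasQExpansion c (0 : ModularForm 𝒮ℒ 0) := hc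
  rw [ModularFormClass.qExpansion_coeff_unique one_pos one_mem_strictPeriods_SL hc' n]
  simp [qExpansion_zero]

end HasQExpansion

/-- The automorphy factor `cτ + d`. -/
def autFactor (g : SL(2, ℤ)) (τ : ℍ) : ℂ := ((g 1 0 : ℤ) : ℂ) * (τ : ℂ) + ((g 1 1 : ℤ) : ℂ)

lemma autFactor_eq_denom (g : SL(2, ℤ)) (τ : ℍ) : autFactor g τ = denom g τ :=
  (ModularGroup.denom_apply g τ).symm

lemma autFactor_ne_zero (g : SL(2, ℤ)) (τ : ℍ) : autFactor g τ ≠ 0 := by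
  rw [autFactor_eq_denom]
  exact denom_ne_zero _ τ

/-- The modular transformation law of a Jacobi form of weight `k` and index `M / 2`. -/
def IsJacobiModular (k : ℤ) (M : ℕ) (φ : ℍ → ℂ → ℂ) : Prop :=
  ∀ (g : SL(2, ℤ)) (τ : ℍ) (z : ℂ), φ (g • τ) (z / autFactor g τ) =
    autFactor g τ ^ k * Complex.exp (2 * Real.pi * Complex.I * ((M : ℂ) / 2) *
      (((g 1 0 : ℤ) : ℂ) * z ^ 2 / autFactor g τ)) * φ τ z

namespace HasFourierJacobi

variable {a b : ℕ × ℤ → ℂ} {φ ψ : ℍ → ℂ → ℂ}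

lemma mdifferentiable (h : HasFourierJacobi a φ) (z : ℂ) : MDiff (fun τ => φ τ z) :=
  mdifferentiable_iff.mpr (h.differentiableOn z)

lemma summable_fiber (h : HasFourierJacobi a φ) (n : ℕ) (z : ℂ) :
    Summable (fun r : ℤ => a (n, r) * fourierTerm (0, r) 0 z) := by
  have h1 := (h UpperHalfPlane.I z).summable.prod_factor n
  have h2 := h1.mul_left (Function.Periodic.qParam 1 (UpperHalfPlane.I : ℂ) ^ n)⁻¹
  refine h2.congr fun r => ?_
  have : Function.Periodic.qParam 1 (UpperHalfPlane.I : ℂ) ^ n ≠ 0 :=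
    pow_ne_zero _ (Function.Periodic.qParam_ne_zero _)
  rw [fourierTerm_eq n r]
  field_simp

lemma hasQExpansion (h : HasFourierJacobi a φ) (z : ℂ) :
    HasQExpansion (fun n => ∑' r : ℤ, a (n, r) * fourierTerm (0, r) 0 z) (fun τ => φ τ z) := by
  intro τ
  refine (h τ z).prod_fiberwise fun n => ?_
  have h1 := (h.summable_fiber n z).hasSum.mul_right (Function.Periodic.qParam 1 (τ : ℂ) ^ n)
  rw [smul_eq_mul]
  convert! h1 using 1
  funext r
  rw [fourierTerm_eq n r]
  ring

/-- If `φ` vanishes to order `j` along `z = 0`, the factor `exp(2πi m c z² / (cτ + d))` does not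
affect the `j`-th Taylor coefficient, which is therefore modular of weight `k + j`. -/
lemma slash_iterate_zetaDeriv (h : HasFourierJacobi a φ) {k : ℤ} {M : ℕ}
    (hm : IsJacobiModular k M φ) {j : ℕ} (hv : VanishesToOrder j φ) (γ : SL(2, ℤ)) :
    (fun τ => (_root_.zetaDeriv^[j] φ) τ 0) ∣[k + (j : ℤ)] γ =
      fun τ => (_root_.zetaDeriv^[j] φ) τ 0 := by
  funext τ
  rw [ModularForm.SL_slash_apply, ← autFactor_eq_denom]
  have hJ := autFactor_ne_zero γ τ
  set J := autFactor γ τ with hJdef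
  have hd (σ : ℍ) : ContDiff ℂ j (φ σ) := (h.differentiable σ).contDiff
  let u : ℂ → ℂ := fun z => J ^ k * Complex.exp (2 * Real.pi * Complex.I * ((M : ℂ) / 2) *
      (((γ 1 0 : ℤ) : ℂ) * z ^ 2 / J))
  have hu : ContDiff ℂ j u := by
    have : Differentiable ℂ u := by fun_prop
    exact this.contDiff
  have e : (fun z => φ (γ • τ) (J⁻¹ * z)) = u * φ τ := by
    funext z
    rw [mul_comm, ← div_eq_mul_inv, hm γ τ z]
    rfl
  have e2 := congrArg (fun F => iteratedDeriv j F 0) e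
  rw [iteratedDeriv_comp_const_mul (hd _), iteratedDeriv_mul hu.contDiffAt (hd τ).contDiffAt,
    Finset.sum_eq_single 0] at e2
  · simp only [mul_zero, iteratedDeriv_eq, iteratedDeriv_zero, Nat.choose_zero_right, Nat.cast_one,
      one_mul, Nat.sub_zero] at e2
    have hu0 : u 0 = J ^ k := by simp [u]
    rw [hu0] at e2
    have hpi : (2 * (Real.pi : ℂ) * Complex.I) ^ j ≠ 0 := pow_ne_zero _ Complex.two_pi_I_ne_zero
    have e3 : (J⁻¹) ^ j * (_root_.zetaDeriv^[j] φ) (γ • τ) 0 =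
        J ^ k * (_root_.zetaDeriv^[j] φ) τ 0 :=
      mul_left_cancel₀ hpi (by linear_combination e2)
    rw [zpow_neg, zpow_add₀ hJ, zpow_natCast, mul_inv, ← inv_pow]
    have hk : J ^ k ≠ 0 := zpow_ne_zero _ hJ
    calc _ = (J ^ k)⁻¹ * ((J⁻¹) ^ j * (_root_.zetaDeriv^[j] φ) (γ • τ) 0) := by ring
      _ = _ := by rw [e3, inv_mul_cancel_left₀ hk]
  · intro i hi hi0
    rw [iteratedDeriv_eq φ, hv (j - i) (by have := Finset.mem_range.mp hi; omega)]
    simp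
  · simp

/-- If the `q^0`-part vanishes, the leading Taylor coefficients are cusp forms, and there are none
of weight less than `12`. -/
lemma vanishesToOrder_of_modular (h : HasFourierJacobi a φ) {k : ℤ} {M : ℕ}
    (hm : IsJacobiModular k M φ) (h0 : ∀ r, a (0, r) = 0) {N : ℕ} (hN : k + N ≤ 12) :
    VanishesToOrder N φ := by
  induction N with
  | zero => intro i hi; omega
  | succ N ih =>
    have ih' := ih (by push_cast at hN; omega)
    intro i hi τ
    rcases Nat.lt_succ_iff_lt_or_eq.mp hi with hi | rfl
    · exact ih' i hi τ
    refine ((h.iterate_zetaDeriv i).hasQExpansion 0).eq_zero_of_weight_lt_twelve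
      ((h.iterate_zetaDeriv i).mdifferentiable 0) (h.slash_iterate_zetaDeriv hm ih')
      (by push_cast at hN; omega) ?_ τ
    simp [h0]

/-- `φ(τ, 0)` is a modular form of weight `2`, hence zero. -/
lemma tsum_eq_zero_of_weight_two (h : HasFourierJacobi a φ) {M : ℕ}
    (hm : IsJacobiModular 2 M φ) : ∑' r : ℤ, a (0, r) = 0 := by
  have hs := h.slash_iterate_zetaDeriv hm (j := 0) (fun i hi => by omega)
  have h1 := (h.hasQExpansion 0).coeff_eq_zero
    ((h.hasQExpansion 0).eq_zero_of_weight_two (h.mdifferentiable 0) (by simpa using hs)) 0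
  simpa [fourierTerm] using h1

end HasFourierJacobi

/-! ### The modified heat operator raises the weight from zero to two -/

/-- Chain rule for `s ↦ φ(u(s), v(s))`, with the partial derivatives in normalized form. -/
lemma HasDerivAt.jacobi_comp {φ : ℍ → ℂ → ℂ}
    (hφ : DifferentiableOn ℂ (fun p : ℂ × ℂ => φ (ofComplex p.1) p.2) {p | 0 < p.1.im})
    {u v : ℂ → ℂ} {u' v' t : ℂ} (hu : HasDerivAt u u' t) (hv : HasDerivAt v v' t)
    (ht : 0 < (u t).im) :
    HasDerivAt (fun s => φ (ofComplex (u s)) (v s))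
      (2 * Real.pi * Complex.I * (qDeriv φ (ofComplex (u t)) (v t) * u' +
        zetaDeriv φ (ofComplex (u t)) (v t) * v')) t := by
  have ho : IsOpen {p : ℂ × ℂ | 0 < p.1.im} :=
    isOpen_lt continuous_const (Complex.continuous_im.comp continuous_fst)
  have hF := (hφ.differentiableAt (x := (u t, v t)) (ho.mem_nhds ht)).hasFDerivAt
  set L := fderiv ℂ (fun p : ℂ × ℂ => φ (ofComplex p.1) p.2) (u t, v t)
  have h1 : HasDerivAt (fun s => φ (ofComplex s) (v t)) (L (1, 0)) (u t) :=
    hF.comp_hasDerivAt (f := fun s => (s, v t)) (u t)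
      ((hasDerivAt_id _).prodMk (hasDerivAt_const _ _))
  have h2 : HasDerivAt (fun s => φ (ofComplex (u t)) s) (L (0, 1)) (v t) :=
    hF.comp_hasDerivAt (f := fun s => (u t, s)) (v t)
      ((hasDerivAt_const _ _).prodMk (hasDerivAt_id _))
  have h3 := hF.comp_hasDerivAt (f := fun s => (u s, v s)) t (hu.prodMk hv)
  convert! h3 using 1
  have e : ((u', v') : ℂ × ℂ) = u' • ((1, 0) : ℂ × ℂ) + v' • ((0, 1) : ℂ × ℂ) := by simp
  have hpi := Complex.two_pi_I_ne_zero
  rw [e, map_add, map_smul, map_smul, ← h1.deriv, ← h2.deriv]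
  simp only [qDeriv, zetaDeriv, Derivative.normalizedDerivOfComplex, smul_eq_mul]
  have e1 : ((ofComplex (u t) : ℍ) : ℂ) = u t := by rw [ofComplex_apply_of_im_pos ht]
  rw [e1]
  simp only [Function.comp_def]
  field_simp

lemma E2_smul (γ : SL(2, ℤ)) (τ : ℍ) :
    EisensteinSeries.E2 (γ • τ) = autFactor γ τ ^ 2 * EisensteinSeries.E2 τ +
      6 * ((γ 1 0 : ℤ) : ℂ) * autFactor γ τ / (Real.pi * Complex.I) := by
  have h := congrFun (EisensteinSeries.E2_slash_action γ) τ
  have hJ := autFactor_ne_zero γ τ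
  rw [ModularForm.SL_slash_apply, ← autFactor_eq_denom] at h
  simp only [Pi.sub_apply, Pi.smul_apply, EisensteinSeries.D2, ← autFactor_eq_denom, smul_eq_mul,
    riemannZeta_two] at h
  have hpi : (Real.pi : ℂ) ≠ 0 := by exact_mod_cast Real.pi_ne_zero
  have h2 : EisensteinSeries.E2 (γ • τ) = autFactor γ τ ^ 2 *
    (EisensteinSeries.E2 (γ • τ) * autFactor γ τ ^ (-2 : ℤ)) := by
    rw [zpow_neg]
    field_simp
  rw [h2, h]
  field_simp
  ring_nf
  simp only [Complex.I_sq]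
  ring

/-- The quasi-modular defect of `E₂` cancels the one produced by the heat operator. -/
theorem isJacobiModular_modHeatOp {a : ℕ × ℤ → ℂ} {φ : ℍ → ℂ → ℂ} (h : HasFourierJacobi a φ)
    (hφ : DifferentiableOn ℂ (fun p : ℂ × ℂ => φ (ofComplex p.1) p.2) {p | 0 < p.1.im})
    {M : ℕ} (hM : 0 < M) (hm : IsJacobiModular 0 M φ) : IsJacobiModular 2 M (modHeatOp M 0 φ) := by
  intro γ τ z
  have hJ := autFactor_ne_zero γ τ
  have hM' : (M : ℂ) ≠ 0 := by exact_mod_cast hM.ne'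
  have hpi := Complex.two_pi_I_ne_zero
  set J := autFactor γ τ with hJdef
  set c : ℂ := ((γ 1 0 : ℤ) : ℂ) with hc
  set A : ℂ := 2 * Real.pi * Complex.I with hA
  set m : ℂ := (M : ℂ) / 2 with hmdef
  have hm0 : m ≠ 0 := div_ne_zero hM' two_ne_zero
  let E : ℂ → ℂ := fun w => Complex.exp (A * m * (c * w ^ 2 / J))
  have hm' (w : ℂ) : φ (γ • τ) (w / J) = E w * φ τ w := by simpa using hm γ τ w
  have hE (w : ℂ) : HasDerivAt E (A * (2 * m * c * w / J) * E w) w := by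
    have := (((((hasDerivAt_id w).pow 2).const_mul c).div_const J).const_mul (A * m)).cexp
    convert! this using 1
    simp only [E, id, Pi.pow_apply]
    push_cast
    ring
  have hz (χ : ℍ → ℂ → ℂ) (hχ : Differentiable ℂ (χ τ)) (w : ℂ) :
      HasDerivAt (χ τ) (A * zetaDeriv χ τ w) w := by
    rw [zetaDeriv, ← mul_assoc, mul_inv_cancel₀ hpi, one_mul]
    exact (hχ w).hasDerivAt
  have hzJ (χ : ℍ → ℂ → ℂ) (hχ : Differentiable ℂ (χ (γ • τ))) (w : ℂ) :
      HasDerivAt (fun s => χ (γ • τ) (s / J)) (A * zetaDeriv χ (γ • τ) (w / J) / J) w := by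
    have h1 : HasDerivAt (χ (γ • τ)) (A * zetaDeriv χ (γ • τ) (w / J)) (w / J) := by
      rw [zetaDeriv, ← mul_assoc, mul_inv_cancel₀ hpi, one_mul]
      exact (hχ _).hasDerivAt
    have h2 := h1.comp w ((hasDerivAt_id w).div_const J)
    convert! h2 using 1
    ring
  have d1 (w : ℂ) : zetaDeriv φ (γ • τ) (w / J) =
      J * (E w * zetaDeriv φ τ w + 2 * m * c * w / J * (E w * φ τ w)) := by
    have e1 := hzJ φ (h.differentiable _) w
    rw [funext hm'] at e1
    have e2 := e1.unique ((hE w).mul (hz φ (h.differentiable τ) w))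
    field_simp at e2 ⊢
    linear_combination e2
  have d2 : zetaDeriv (zetaDeriv φ) (γ • τ) (z / J) =
      J ^ 2 * E z * (zetaDeriv (zetaDeriv φ) τ z + 4 * m * c * z / J * zetaDeriv φ τ z +
        ((2 * m * c * z / J) ^ 2 + 2 * m * c / (J * A)) * φ τ z) := by
    have e1 := hzJ (zetaDeriv φ) (h.zetaDeriv.differentiable _) z
    rw [funext d1] at e1
    have e3 : HasDerivAt (fun w : ℂ => 2 * m * c * w / J) (2 * m * c / J) z := by
      convert! ((hasDerivAt_id z).const_mul (2 * m * c)).div_const J using 1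
      ring
    have e2 := e1.unique ((((hE z).mul (hz _ (h.zetaDeriv.differentiable τ) z)).add
      (e3.mul ((hE z).mul (hz φ (h.differentiable τ) z)))).const_mul J)
    simp only [Pi.mul_apply] at e2
    field_simp at e2 ⊢
    linear_combination e2
  -- in `τ` the argument `z / (cτ + d)` moves as well, which produces the `zetaDeriv` term
  have dq : qDeriv φ (γ • τ) (z / J) =
      J ^ 2 * E z * (qDeriv φ τ z - m * c ^ 2 * z ^ 2 / J ^ 2 * φ τ z) +
      c * z * zetaDeriv φ (γ • τ) (z / J) := by
    set d : ℂ := ((γ 1 1 : ℤ) : ℂ)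
    have hJτ : c * (τ : ℂ) + d = J := rfl
    have hl : HasDerivAt (fun t : ℂ => c * t + d) c τ := by
      simpa using ((hasDerivAt_id (τ : ℂ)).const_mul c).add_const d
    have hu : HasDerivAt (fun t : ℂ => ((γ • ofComplex t : ℍ) : ℂ)) (1 / J ^ 2) τ := by
      have hdet : (γ : GL (Fin 2) ℝ).val.det = 1 := by
        rw [← Matrix.GeneralLinearGroup.val_det_apply]; simp
      have := (hasStrictDerivAt_smul (g := (γ : GL (Fin 2) ℝ))
        (by rw [hdet]; exact one_pos) τ).hasDerivAt
      rw [← autFactor_eq_denom, ← hJdef, hdet, Complex.ofReal_one] at this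
      exact this
    have hv : HasDerivAt (fun t : ℂ => z / (c * t + d)) (-(z * c) / J ^ 2) τ := by
      have := (hasDerivAt_const (τ : ℂ) z).div hl (by rwa [hJτ])
      convert! this using 1
      rw [hJτ]; simp
    have h1 := HasDerivAt.jacobi_comp hφ hu hv (UpperHalfPlane.im_pos _)
    simp only [ofComplex_apply, hJτ] at h1
    have hw : HasDerivAt (fun t : ℂ => Complex.exp (A * m * (c * z ^ 2 / (c * t + d))))
        (E z * (A * m * (-(c * z ^ 2 * c) / J ^ 2))) τ := by
      have := (((hasDerivAt_const (τ : ℂ) (c * z ^ 2)).div hl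
        (by rwa [hJτ])).const_mul (A * m)).cexp
      convert! this using 1
      simp only [Pi.div_apply, hJτ, E]
      simp
    have hq : HasDerivAt (fun t : ℂ => φ (ofComplex t) z) (A * qDeriv φ τ z) τ := by
      have := HasDerivAt.jacobi_comp hφ (hasDerivAt_id (τ : ℂ))
        (hasDerivAt_const (τ : ℂ) z) τ.im_pos
      simpa using this
    have h2 := hw.mul hq
    have heq : (fun t : ℂ => φ (γ • ofComplex t) (z / (c * t + d))) =ᶠ[nhds (τ : ℂ)]
        ((fun t : ℂ => Complex.exp (A * m * (c * z ^ 2 / (c * t + d)))) *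
          fun t : ℂ => φ (ofComplex t) z) := by
      filter_upwards [isOpen_upperHalfPlaneSet.mem_nhds τ.im_pos] with t ht
      have := hm γ (ofComplex t) z
      rw [autFactor, ofComplex_apply_of_im_pos ht] at this
      simp only [ofComplex_apply_of_im_pos ht, Pi.mul_apply]
      simpa using this
    have h3 := h1.unique (h2.congr_of_eventuallyEq heq)
    simp only [ofComplex_apply, hJτ] at h3
    change _ = E z * _ * _ + E z * _ at h3
    rw [← hA] at h3
    field_simp at h3 ⊢
    linear_combination h3
  have hE2 := E2_smul γ τ
  rw [← hJdef, ← hc] at hE2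
  simp only [modHeatOp, heatOp]
  rw [dq, d2, hE2, d1, hm', ← hmdef]
  change _ = J ^ (2 : ℤ) * E z * _
  have hpi' : (Real.pi : ℂ) ≠ 0 := by exact_mod_cast Real.pi_ne_zero
  have hI := Complex.I_ne_zero
  rw [hA]
  field_simp
  push_cast
  ring

/-! ### Uniqueness of Fourier coefficients and the elliptic bound -/

lemma HasQExpansion.coeff_unique {c d : ℕ → ℂ} {f : ℍ → ℂ} (hc : HasQExpansion c f)
    (hd : HasQExpansion d f) (n : ℕ) : c n = d n := by
  have h : HasQExpansion (fun n => c n - d n) (fun τ => f τ - f τ) := fun τ => by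
    simpa only [sub_smul] using (hc τ).sub (hd τ)
  exact sub_eq_zero.mp (h.coeff_eq_zero (fun τ => sub_self _) n)

lemma HasQExpansion.const_mul {c : ℕ → ℂ} {f : ℍ → ℂ} (hc : HasQExpansion c f) (x : ℂ) :
    HasQExpansion (fun n => x * c n) (fun τ => x * f τ) := fun τ => by
  simpa only [smul_eq_mul, mul_assoc] using (hc τ).mul_left x

lemma HasQExpansion.qParam_pow_mul {c : ℕ → ℂ} {f : ℍ → ℂ} (hc : HasQExpansion c f) (t : ℕ) :
    HasQExpansion (fun n => if t ≤ n then c (n - t) else 0)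
      (fun τ => Function.Periodic.qParam 1 (τ : ℂ) ^ t * f τ) := fun τ => by
  rw [← (add_left_injective t).hasSum_iff]
  · convert! (hc τ).mul_left (Function.Periodic.qParam 1 (τ : ℂ) ^ t) using 1
    funext n
    simp only [Function.comp, Nat.le_add_left, if_true, Nat.add_sub_cancel, smul_eq_mul, pow_add]
    ring
  · intro n hn
    have : ¬ t ≤ n := fun h => hn ⟨n - t, Nat.sub_add_cancel h⟩
    simp [this]

lemma integral_fourierTerm (r s : ℤ) :
    ∫ x in (0 : ℝ)..2, fourierTerm (0, r - s) 0 x = if r = s then 2 else 0 := by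
  split_ifs with h
  · subst h
    simp [fourierTerm]
  · have hrs : ((r : ℂ) - s) ≠ 0 := by exact_mod_cast sub_ne_zero.mpr h
    have hc : (2 * Real.pi * Complex.I * (((r : ℂ) - s) / 2)) ≠ 0 :=
      mul_ne_zero Complex.two_pi_I_ne_zero (div_ne_zero hrs two_ne_zero)
    have e : (fun x : ℝ => fourierTerm (0, r - s) 0 x) =
        fun x : ℝ => Complex.exp ((2 * Real.pi * Complex.I * (((r : ℂ) - s) / 2)) * x) := by
      funext x
      rw [fourierTerm]
      congr 1
      push_cast; ring
    rw [e, integral_exp_mul_complex hc]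
    have h2 : (2 * Real.pi * Complex.I * (((r : ℂ) - s) / 2)) * ((2 : ℝ) : ℂ) =
        ((r - s : ℤ) : ℂ) * (2 * Real.pi * Complex.I) := by push_cast; ring
    rw [h2, Complex.exp_int_mul_two_pi_mul_I]
    simp

lemma continuous_fourierTerm (p : ℕ × ℤ) (t : ℂ) : Continuous (fun x : ℝ => fourierTerm p t x) := by
  unfold fourierTerm; fun_prop

lemma fourierTerm_zero_mul (r s : ℤ) (z : ℂ) :
    fourierTerm (0, r) 0 z * fourierTerm (0, s) 0 z = fourierTerm (0, r + s) 0 z := by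
  simp only [fourierTerm, ← Complex.exp_add]
  congr 1
  push_cast; ring

/-- A Laurent series in `ζ^(1/2)` that converges absolutely to zero has zero coefficients: integrate
against `ζ^(-s/2)` over the period `[0, 2]`. -/
lemma fourier_coeff_eq_zero {c : ℤ → ℂ}
    (h : ∀ z : ℂ, HasSum (fun r => c r * fourierTerm (0, r) 0 z) 0) (s : ℤ) : c s = 0 := by
  have hs : Summable fun r => ‖c r‖ := by
    have h0 := (h 0).summable.norm
    refine h0.congr fun r => ?_
    rw [norm_mul, norm_fourierTerm]
    simp
  have hF (x : ℝ) : HasSum (fun r => c r * fourierTerm (0, r - s) 0 x) 0 := by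
    have h3 := (h x).mul_right (fourierTerm (0, -s) 0 x)
    rw [zero_mul] at h3
    refine h3.congr_fun fun r => ?_
    rw [mul_assoc, fourierTerm_zero_mul, ← sub_eq_add_neg]
  have h1 := intervalIntegral.hasSum_integral_of_dominated_convergence
    (μ := MeasureTheory.volume) (a := 0) (b := 2)
    (F := fun (r : ℤ) (x : ℝ) => c r * fourierTerm (0, r - s) 0 x) (f := fun _ => 0)
    (bound := fun r _ => ‖c r‖)
    (fun r => ((continuous_fourierTerm _ _).const_mul _).aestronglyMeasurable)
    (fun r => Filter.Eventually.of_forall fun x _ => by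
      rw [norm_mul, norm_fourierTerm]; simp)
    (Filter.Eventually.of_forall fun _ _ => hs)
    intervalIntegrable_const
    (Filter.Eventually.of_forall fun x _ => hF x)
  have h4 : ∀ r, ∫ x in (0 : ℝ)..2, c r * fourierTerm (0, r - s) 0 x =
      if r = s then c s * 2 else 0 := fun r => by
    rw [intervalIntegral.integral_const_mul, integral_fourierTerm]
    split_ifs with h
    · rw [h]
    · simp
  simp only [h4, intervalIntegral.integral_zero] at h1
  have h5 := h1.unique (hasSum_ite_eq s (c s * 2))
  simpa using h5.symm

/-- The coefficient of `ζ^(r/2)`, as a function of `τ`. -/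
def zetaCoeff (a : ℕ × ℤ → ℂ) (r : ℤ) (τ : ℍ) : ℂ :=
  ∑' n : ℕ, a (n, r) * Function.Periodic.qParam 1 (τ : ℂ) ^ n

namespace HasFourierJacobi

variable {a b : ℕ × ℤ → ℂ} {φ ψ : ℍ → ℂ → ℂ}

lemma hasQExpansion_zetaCoeff (h : HasFourierJacobi a φ) (r : ℤ) :
    HasQExpansion (fun n => a (n, r)) (zetaCoeff a r) := fun τ => by
  have h1 := ((Equiv.prodComm ℤ ℕ).summable_iff.mpr (h τ 0).summable).prod_factor r
  refine Summable.hasSum ?_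
  refine h1.congr fun n => ?_
  simp only [Function.comp, Equiv.prodComm_apply, Prod.swap_prod_mk, smul_eq_mul]
  rw [fourierTerm_eq n r]
  simp [fourierTerm]

lemma hasSum_zetaCoeff (h : HasFourierJacobi a φ) (τ : ℍ) (z : ℂ) :
    HasSum (fun r => zetaCoeff a r τ * fourierTerm (0, r) 0 z) (φ τ z) := by
  refine ((Equiv.prodComm ℤ ℕ).hasSum_iff.mpr (h τ z)).prod_fiberwise fun r => ?_
  convert! (h.hasQExpansion_zetaCoeff r τ).mul_right (fourierTerm (0, r) 0 z) using 1
  funext n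
  simp only [Function.comp, Equiv.prodComm_apply, Prod.swap_prod_mk, smul_eq_mul]
  rw [fourierTerm_eq n r]; ring

lemma coeff_unique (h : HasFourierJacobi a φ) (h' : HasFourierJacobi b φ) (n : ℕ) (r : ℤ) :
    a (n, r) = b (n, r) := by
  have e : zetaCoeff a r = zetaCoeff b r := funext fun τ => by
    refine sub_eq_zero.mp (fourier_coeff_eq_zero (c := fun r => zetaCoeff a r τ - zetaCoeff b r τ)
      (fun z => ?_) r)
    simpa only [sub_mul, sub_self] using (h.hasSum_zetaCoeff τ z).sub (h'.hasSum_zetaCoeff τ z)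
  exact (h.hasQExpansion_zetaCoeff r).coeff_unique (e ▸ h'.hasQExpansion_zetaCoeff r) n

lemma coeff_neg (h : HasFourierJacobi a φ) (he : ∀ τ z, φ τ (-z) = φ τ z) (n : ℕ) (r : ℤ) :
    a (n, -r) = a (n, r) := by
  refine coeff_unique (a := fun p => a (p.1, -p.2)) (fun τ z => ?_) h n r
  have h1 := ((Equiv.refl ℕ).prodCongr (Equiv.neg ℤ)).hasSum_iff.mpr (h τ (-z))
  rw [he] at h1
  convert! h1 using 1
  funext p
  simp only [fourierTerm, Function.comp, Equiv.prodCongr_apply, Prod.map, Equiv.refl_apply,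
    Equiv.neg_apply]
  congr 2
  push_cast; ring

/-- The elliptic law for `z ↦ z + τ` gives `c_r(τ) = ± q^t c_{r + 2M}(τ)` for the coefficient
`c_r(τ)` of `ζ^(r/2)`, where `r = -M - 2t`. -/
lemma coeff_eq_zero_of_lt_neg_index (h : HasFourierJacobi a φ) {M : ℕ}
    (hell : ∀ (τ : ℍ) (z : ℂ), φ τ (z + τ) = (-1) ^ M *
      Complex.exp (-(2 * Real.pi * Complex.I * ((M : ℂ) / 2) * (τ + 2 * z))) * φ τ z)
    {r : ℤ} {t : ℕ} (ht : 0 < t) (hr : r = -(M : ℤ) - 2 * t) : a (0, r) = 0 := by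
  have key (τ : ℍ) : zetaCoeff a r τ =
      Function.Periodic.qParam 1 (τ : ℂ) ^ t * ((-1) ^ M * zetaCoeff a (r + 2 * M) τ) := by
    have h1 (z : ℂ) : HasSum (fun r => (zetaCoeff a r τ * fourierTerm (0, r) 0 τ) *
        fourierTerm (0, r) 0 z) (φ τ (z + τ)) := by
      convert! h.hasSum_zetaCoeff τ (z + τ) using 1
      funext s
      rw [mul_assoc]
      congr 1
      simp only [fourierTerm, ← Complex.exp_add]
      congr 1
      ring
    have h2 (z : ℂ) : HasSum (fun r : ℤ => ((-1) ^ M * fourierTerm (0, -(M : ℤ)) 0 τ *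
        zetaCoeff a (r + 2 * M) τ) * fourierTerm (0, r) 0 z) (φ τ (z + τ)) := by
      have h3 := (Equiv.addRight (2 * (M : ℤ))).hasSum_iff.mpr ((h.hasSum_zetaCoeff τ z).mul_left
        ((-1) ^ M * Complex.exp (-(2 * Real.pi * Complex.I * ((M : ℂ) / 2) * (τ + 2 * z)))))
      rw [← hell] at h3
      convert! h3 using 1
      funext s
      simp only [Function.comp, Equiv.coe_addRight]
      have : Complex.exp (-(2 * Real.pi * Complex.I * ((M : ℂ) / 2) * (τ + 2 * z))) *
          fourierTerm (0, s + 2 * M) 0 z =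
            fourierTerm (0, -(M : ℤ)) 0 τ * fourierTerm (0, s) 0 z := by
        simp only [fourierTerm, ← Complex.exp_add]
        congr 1
        push_cast; ring
      linear_combination (-(-1) ^ M * zetaCoeff a (s + 2 * M) τ) * this
    have h4 := fourier_coeff_eq_zero (c := fun r => zetaCoeff a r τ * fourierTerm (0, r) 0 τ -
      (-1) ^ M * fourierTerm (0, -(M : ℤ)) 0 τ * zetaCoeff a (r + 2 * M) τ)
      (fun z => by simpa only [sub_mul, sub_self] using (h1 z).sub (h2 z)) r
    have h5 : fourierTerm (0, -(M : ℤ)) 0 τ =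
        Function.Periodic.qParam 1 (τ : ℂ) ^ t * fourierTerm (0, r) 0 τ := by
      rw [Function.Periodic.qParam, fourierTerm, fourierTerm, ← Complex.exp_nat_mul,
        ← Complex.exp_add, hr]
      congr 1
      push_cast; ring
    have h6 : fourierTerm (0, r) 0 τ ≠ 0 := Complex.exp_ne_zero _
    rw [h5] at h4
    refine mul_right_cancel₀ h6 ?_
    linear_combination h4
  have h7 : HasQExpansion (fun n => (-1) ^ M * a (n, r + 2 * M))
      (fun τ => (-1) ^ M * zetaCoeff a (r + 2 * M) τ) := fun τ => by
    simpa only [smul_eq_mul, mul_assoc] using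
      (h.hasQExpansion_zetaCoeff (r + 2 * M) τ).mul_left ((-1) ^ M)
  have h8 := h7.qParam_pow_mul t
  rw [← funext key] at h8
  rw [(h.hasQExpansion_zetaCoeff r).coeff_unique h8 0]
  simp [ht.ne']

end HasFourierJacobi

/-! ### The indicial cubic and the constant term in q -/

/-- The transformation law for `-1 ∈ SL(2, ℤ)`, in weight `0`. -/
lemma IsWeakJacobiForm.even {M : ℕ} {φ : ℍ → ℂ → ℂ} (hφ : IsWeakJacobiForm 0 M φ) (τ : ℍ) (z : ℂ) :
    φ τ (-z) = φ τ z := by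
  simpa [div_neg] using hφ.modular (-1) τ z

lemma IsWeakJacobiForm.elliptic_one {k : ℤ} {M : ℕ} {φ : ℍ → ℂ → ℂ} (hφ : IsWeakJacobiForm k M φ)
    (τ : ℍ) (z : ℂ) : φ τ (z + τ) = (-1) ^ M *
      Complex.exp (-(2 * Real.pi * Complex.I * ((M : ℂ) / 2) * (τ + 2 * z))) * φ τ z := by
  simpa using hφ.elliptic 1 0 τ z

/-- `x = (3/m) l² - 1/2` for `m = M / 2` and `l = r / 2`; `H_0` acts on `q^0 ζ^l` by `-x`. -/
def indicialRoot (M : ℕ) (r : ℤ) : ℂ := 3 / ((M : ℂ) / 2) * ((r : ℂ) / 2) ^ 2 - 1 / 2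

lemma indicialRoot_eq_iff {M : ℕ} (hM : 0 < M) {r s : ℤ} :
    indicialRoot M r = indicialRoot M s ↔ |r| = |s| := by
  have hM' : (M : ℂ) ≠ 0 := by exact_mod_cast hM.ne'
  rw [← sq_eq_sq_iff_abs_eq_abs, indicialRoot, indicialRoot]
  constructor
  · intro h
    field_simp at h
    have h2 : (r : ℂ) ^ 2 = (s : ℂ) ^ 2 := by linear_combination h / 3
    exact_mod_cast h2
  · intro h
    have h2 : (r : ℂ) ^ 2 = (s : ℂ) ^ 2 := by exact_mod_cast h
    rw [div_pow, div_pow, h2]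

lemma indicialRoot_abs (M : ℕ) (r : ℤ) : indicialRoot M |r| = indicialRoot M r := by
  rw [indicialRoot, indicialRoot, div_pow, div_pow]
  norm_cast
  rw [sq_abs]

lemma neg_half_le_re_indicialRoot (M : ℕ) (r : ℤ) : -(1 / 2) ≤ (indicialRoot M r).re := by
  have : indicialRoot M r = ((3 / ((M : ℝ) / 2) * ((r : ℝ) / 2) ^ 2 - 1 / 2 : ℝ) : ℂ) := by
    rw [indicialRoot]; push_cast; ring
  rw [this, Complex.ofReal_re]
  have : 0 ≤ 3 / ((M : ℝ) / 2) * ((r : ℝ) / 2) ^ 2 := by positivity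
  linarith

/-- Comparing coefficients of `q^0 ζ^(r/2)` in the differential equation, where `H_0`, `H_2`, `H_4`
act with eigenvalues `-x`, `-(x + 2)`, `-(x + 4)`. -/
lemma HasFourierJacobi.indicial_equation {a : ℕ × ℤ → ℂ} {φ : ℍ → ℂ → ℂ} {M : ℕ} {lam₁ lam₂ : ℂ}
    (h : HasFourierJacobi a φ) (hMDE : SatisfiesThirdOrderMDE M 0 lam₁ lam₂ φ) {r : ℤ}
    (hr : a (0, r) ≠ 0) :
    indicialRoot M r ^ 3 + 6 * indicialRoot M r ^ 2 + (8 + lam₁) * indicialRoot M r - lam₂ = 0 := by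
  obtain ⟨c₄, hc₄, hc₄0⟩ := hasQExpansion_E (k := 4) (by norm_num) ⟨2, rfl⟩
  obtain ⟨c₆, hc₆, hc₆0⟩ := hasQExpansion_E (k := 6) (by norm_num) ⟨3, rfl⟩
  obtain ⟨b₁, h₁, e₁⟩ := h.modHeatOp M 0
  obtain ⟨b₂, h₂, e₂⟩ := h₁.modHeatOp M 2
  obtain ⟨b₃, h₃, e₃⟩ := h₂.modHeatOp M 4
  have hs := (h₃.add ((h₁.qMul hc₄).const_mul lam₁)).add ((h.qMul hc₆).const_mul lam₂)
  have h0 : HasFourierJacobi (fun _ => 0) (fun τ z =>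
      _root_.modHeatOp M 4 (_root_.modHeatOp M 2 (_root_.modHeatOp M 0 φ)) τ z +
      lam₁ * (ModularForm.E (k := 4) (by norm_num) τ * _root_.modHeatOp M 0 φ τ z) +
      lam₂ * (ModularForm.E (k := 6) (by norm_num) τ * φ τ z)) := by
    intro τ z
    have := hMDE τ z
    change _root_.modHeatOp M 4
      (_root_.modHeatOp M 2 (_root_.modHeatOp M 0 φ)) τ z + _ + _ = 0 at this
    simp only [zero_mul]
    convert! hasSum_zero using 1
    linear_combination this
  have h2 := hs.coeff_unique h0 0 r
  simp only [Finset.HasAntidiagonal.antidiagonal] at h2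
  simp [e₃, e₂, e₁, hc₄0, hc₆0] at h2
  refine mul_right_cancel₀ hr ?_
  rw [indicialRoot]
  linear_combination -h2

lemma cubic_vieta {p q x y : ℂ} (hxy : x ≠ y) (hx : x ^ 3 + 6 * x ^ 2 + (8 + p) * x - q = 0)
    (hy : y ^ 3 + 6 * y ^ 2 + (8 + p) * y - q = 0) :
    p = -(x ^ 2 + x * y + y ^ 2 + 6 * (x + y) + 8) ∧ q = -(x * y * (x + y + 6)) := by
  have hp : p = -(x ^ 2 + x * y + y ^ 2 + 6 * (x + y) + 8) := by
    refine mul_left_cancel₀ (sub_ne_zero.mpr hxy) ?_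
    linear_combination hx - hy
  refine ⟨hp, ?_⟩
  subst hp
  linear_combination -hx

namespace HasFourierJacobi

variable {a : ℕ × ℤ → ℂ} {φ : ℍ → ℂ → ℂ} {M : ℕ} {lam₁ lam₂ : ℂ}

/-- Otherwise `φ` vanishes to order `6` along `z = 0`, and the equation forces `φ = 0`. -/
lemma exists_coeff_ne_zero (h : HasFourierJacobi a φ) (hM : 0 < M) (hm : IsJacobiModular 0 M φ)
    (hne : ∃ (τ : ℍ) (z : ℂ), _root_.modHeatOp M 0 φ τ z ≠ 0)
    (hMDE : SatisfiesThirdOrderMDE M 0 lam₁ lam₂ φ) : ∃ r, a (0, r) ≠ 0 := by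
  by_contra! h0
  obtain ⟨c₄, hc₄, -⟩ := hasQExpansion_E (k := 4) (by norm_num) ⟨2, rfl⟩
  obtain ⟨c₆, hc₆, -⟩ := hasQExpansion_E (k := 6) (by norm_num) ⟨3, rfl⟩
  have hφ0 := h.eq_zero_of_thirdOrder hM (k₁ := 4) (k₂ := 2) (k₃ := 0) (k₄ := 0)
    (hMDE) (hc₄.const_mul lam₁) (hc₆.const_mul lam₂)
    (h.vanishesToOrder_of_modular hm h0 (N := 6) (by norm_num))
  obtain ⟨τ, z, hτ⟩ := hne
  apply hτ
  obtain rfl : φ = fun _ _ => 0 := funext fun τ => funext fun z => hφ0 τ z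
  have : _root_.zetaDeriv (fun _ _ => 0) = fun _ _ => 0 := iterate_zetaDeriv_zero 1
  simp only [_root_.modHeatOp, _root_.heatOp, this]
  have h2 : _root_.qDeriv (fun _ _ => 0) τ z = 0 :=
    congrFun (Derivative.normalizedDerivOfComplex_const 0) τ
  simp [h2]

/-- The constant term of the modular form `(H_0 φ)(τ, 0)` of weight `2`. -/
lemma tsum_indicialRoot_mul_coeff (h : HasFourierJacobi a φ) (hM : 0 < M)
    (hol : DifferentiableOn ℂ (fun p : ℂ × ℂ => φ (ofComplex p.1) p.2) {p | 0 < p.1.im})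
    (hm : IsJacobiModular 0 M φ) : ∑' r : ℤ, indicialRoot M r * a (0, r) = 0 := by
  obtain ⟨b, hb, eb⟩ := h.modHeatOp M 0
  have h1 := hb.tsum_eq_zero_of_weight_two (isJacobiModular_modHeatOp h hol hM hm)
  rw [← neg_eq_zero, ← tsum_neg, ← h1]
  refine tsum_congr fun r => ?_
  rw [eb, indicialRoot]
  push_cast; ring

/-- Otherwise `lam₂ = 0` and `ψ = H_0 φ` has no `q^0`-part, so it vanishes to order `4` along `z =
0`; the second-order equation `(H_4 H_2 + lam₁ E₄) ψ = 0` then forces `ψ = 0`. -/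
lemma exists_indicialRoot_ne_zero (h : HasFourierJacobi a φ) (hM : 0 < M)
    (hol : DifferentiableOn ℂ (fun p : ℂ × ℂ => φ (ofComplex p.1) p.2) {p | 0 < p.1.im})
    (hm : IsJacobiModular 0 M φ)
    (hne : ∃ (τ : ℍ) (z : ℂ), _root_.modHeatOp M 0 φ τ z ≠ 0)
    (hMDE : SatisfiesThirdOrderMDE M 0 lam₁ lam₂ φ) : ∃ r, a (0, r) ≠ 0 ∧ indicialRoot M r ≠ 0 := by
  by_contra! h0
  obtain ⟨r, hr⟩ := h.exists_coeff_ne_zero hM hm hne hMDE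
  have hlam : lam₂ = 0 := by
    have := h.indicial_equation hMDE hr
    rw [h0 r hr] at this
    simpa using this
  obtain ⟨c₄, hc₄, -⟩ := hasQExpansion_E (k := 4) (by norm_num) ⟨2, rfl⟩
  obtain ⟨b, hb, eb⟩ := h.modHeatOp M 0
  have hb0 (r : ℤ) : b (0, r) = 0 := by
    have e : b (0, r) = -(indicialRoot M r * a (0, r)) := by
      rw [eb, indicialRoot]; push_cast; ring
    by_cases hr : a (0, r) = 0
    · simp [e, hr]
    · simp [e, h0 r hr]
  obtain ⟨τ, z, hτ⟩ := hne
  refine hτ (hb.eq_zero_of_secondOrder hM (k₁ := 4) (k₂ := 2) (fun τ z => ?_) (hc₄.const_mul lam₁)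
    (hb.vanishesToOrder_of_modular (isJacobiModular_modHeatOp h hol hM hm) hb0 (by norm_num)) τ z)
  have := hMDE τ z
  rw [hlam, zero_mul, zero_mul, add_zero] at this
  exact this

end HasFourierJacobi

lemma HasWeakJacobiExpansion.hasFourierJacobi {M : ℕ} {φ : ℍ → ℂ → ℂ} {a : ℕ → ℤ → ℂ}
    (ha : HasWeakJacobiExpansion M φ a) : HasFourierJacobi (fun p => a p.1 p.2) φ :=
  ha.hasSum

/-- By evenness it suffices to exclude `r < -M`; there `-M - r` is even by the parity condition on the
support. -/
lemma IsWeakJacobiForm.abs_le_of_coeff_ne_zero {M : ℕ} {φ : ℍ → ℂ → ℂ} {a : ℕ → ℤ → ℂ}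
    (hφ : IsWeakJacobiForm 0 M φ) (ha : HasWeakJacobiExpansion M φ a) {r : ℤ} (hr : a 0 r ≠ 0) :
    |r| ≤ M := by
  have h := ha.hasFourierJacobi
  by_contra! hlt
  have hpar := (ha.support 0 r hr).dvd
  have hneg : a 0 (-|r|) ≠ 0 := by
    rcases abs_choice r with e | e <;> rw [e]
    · rwa [show a 0 (-r) = a 0 r from h.coeff_neg hφ.even 0 r]
    · rwa [neg_neg]
  refine hneg (h.coeff_eq_zero_of_lt_neg_index hφ.elliptic_one (t := ((|r| - M) / 2).toNat) ?_ ?_)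
  all_goals rcases abs_cases r with ⟨e, -⟩ | ⟨e, -⟩ <;> omega

end

theorem mainTheorem7 (M : ℕ) (hM : 0 < M) (φ : ℍ → ℂ → ℂ)
    (hφ : IsWeakJacobiForm 0 M φ)
    (a : ℕ → ℤ → ℂ) (ha : HasWeakJacobiExpansion M φ a)
    (hne : ∃ (τ : ℍ) (z : ℂ), modHeatOp M 0 φ τ z ≠ 0)
    (lam₁ lam₂ : ℂ) (hMDE : SatisfiesThirdOrderMDE M 0 lam₁ lam₂ φ) :
    ∃ r₁ r₂ : ℤ, 0 ≤ r₁ ∧ r₁ < r₂ ∧ r₂ ≤ (M : ℤ) ∧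
      (∀ r : ℤ, a 0 r ≠ 0 ↔ (|r| = r₁ ∨ |r| = r₂)) ∧
      (let m : ℂ := (M : ℂ) / 2
       let l₁ : ℂ := (r₁ : ℂ) / 2
       let l₂ : ℂ := (r₂ : ℂ) / 2
       let x₁ : ℂ := 3 / m * l₁ ^ 2 - 1 / 2
       let x₂ : ℂ := 3 / m * l₂ ^ 2 - 1 / 2
       (r₁ ≠ 0 → (6 * l₁ ^ 2 - m) * a 0 r₁ = -((6 * l₂ ^ 2 - m) * a 0 r₂)) ∧
       (r₁ = 0 → m * a 0 0 = 2 * (6 * l₂ ^ 2 - m) * a 0 r₂) ∧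
       lam₁ = -(x₁ ^ 2 + x₁ * x₂ + x₂ ^ 2 + 6 * (x₁ + x₂) + 8) ∧
       lam₂ = -(x₁ * x₂ * (x₁ + x₂ + 6))) := by
  have h := ha.hasFourierJacobi
  have hm : IsJacobiModular 0 M φ := hφ.modular
  have hM' : (M : ℂ) ≠ 0 := by exact_mod_cast hM.ne'
  have heven (r : ℤ) : a 0 (-r) = a 0 r := h.coeff_neg hφ.even 0 r
  have habs (r : ℤ) : a 0 |r| = a 0 r := by
    rcases abs_choice r with e | e <;> rw [e]
    exact heven r
  have hsum : ∑' r : ℤ, indicialRoot M r * a 0 r = 0 := h.tsum_indicialRoot_mul_coeff hM hφ.holo hm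
  obtain ⟨r, hr, hxr⟩ := h.exists_indicialRoot_ne_zero hM hφ.holo hm hne hMDE
  -- were `r` and `-r` the only indices, `hsum` would be a nonzero multiple of `indicialRoot M r`
  obtain ⟨s, hs, hrs⟩ : ∃ s, a 0 s ≠ 0 ∧ |r| ≠ |s| := by
    by_contra! hall
    have hsupp : ∀ s ∉ ({r, -r} : Finset ℤ), indicialRoot M s * a 0 s = 0 := fun s hs => by
      by_contra hne0
      apply hs
      simpa [eq_comm] using abs_eq_abs.mp (hall s (right_ne_zero_of_mul hne0)).symm
    rw [tsum_eq_sum hsupp] at hsum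
    by_cases hr0 : r = 0
    · subst hr0
      simp at hsum
      tauto
    · rw [Finset.sum_pair (by omega), heven, ← indicialRoot_abs M (-r), abs_neg, indicialRoot_abs,
        ← two_mul] at hsum
      simp at hsum
      tauto
  obtain ⟨r₁, r₂, h0, hlt, hr₁, hr₂⟩ : ∃ r₁ r₂ : ℤ, 0 ≤ r₁ ∧ r₁ < r₂ ∧ a 0 r₁ ≠ 0 ∧ a 0 r₂ ≠ 0 := by
    rcases lt_or_gt_of_ne hrs with hlt | hlt
    · exact ⟨|r|, |s|, abs_nonneg r, hlt, by rwa [habs], by rwa [habs]⟩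
    · exact ⟨|s|, |r|, abs_nonneg s, hlt, by rwa [habs], by rwa [habs]⟩
  have hroot (t : ℤ) (ht : a 0 t ≠ 0) := h.indicial_equation hMDE (r := t) ht
  have hx : indicialRoot M r₁ ≠ indicialRoot M r₂ := by
    rw [Ne, indicialRoot_eq_iff hM, abs_of_nonneg h0, abs_of_nonneg (h0.trans hlt.le)]
    exact hlt.ne
  have hv := cubic_vieta hx (hroot _ hr₁) (hroot _ hr₂)
  have hiff (t : ℤ) : a 0 t ≠ 0 ↔ |t| = r₁ ∨ |t| = r₂ := by
    constructor
    · intro ht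
      by_contra! hne'
      have hx₁ : indicialRoot M t ≠ indicialRoot M r₁ := by
        rw [Ne, indicialRoot_eq_iff hM, abs_of_nonneg h0]
        exact hne'.1
      have hx₂ : indicialRoot M t ≠ indicialRoot M r₂ := by
        rw [Ne, indicialRoot_eq_iff hM, abs_of_nonneg (h0.trans hlt.le)]
        exact hne'.2
      -- three distinct roots of the cubic sum to `-6`, yet each has real part at least `-1/2`
      have hv' := (cubic_vieta hx₁ (hroot _ ht) (hroot _ hr₁)).1
      have hsum6 : indicialRoot M t + indicialRoot M r₁ + indicialRoot M r₂ + 6 = 0 := by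
        refine (mul_eq_zero.mp ?_).resolve_left (sub_ne_zero.mpr hx₂)
        linear_combination hv' - hv.1
      have hre := congrArg Complex.re hsum6
      simp only [Complex.add_re, Complex.zero_re, Complex.re_ofNat] at hre
      linarith [neg_half_le_re_indicialRoot M t, neg_half_le_re_indicialRoot M r₁,
        neg_half_le_re_indicialRoot M r₂]
    · rintro (e | e) <;> rw [← habs, e] <;> assumption
  have hle : r₂ ≤ M := (le_abs_self r₂).trans (hφ.abs_le_of_coeff_ne_zero ha hr₂)
  refine ⟨r₁, r₂, h0, hlt, hle, hiff, ?_, ?_, hv.1, hv.2⟩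
  · intro hr₁0
    have hsupp : ∀ s ∉ ({r₁, -r₁, r₂, -r₂} : Finset ℤ),
        indicialRoot M s * a 0 s = 0 := fun s hs => by
      by_contra hne0
      apply hs
      have := (hiff s).mp (right_ne_zero_of_mul hne0)
      simp only [Finset.mem_insert, Finset.mem_singleton]
      rcases abs_cases s with ⟨e, -⟩ | ⟨e, -⟩ <;> omega
    rw [tsum_eq_sum hsupp, Finset.sum_insert (by simp; omega), Finset.sum_insert (by simp; omega),
      Finset.sum_pair (by omega), heven, heven] at hsum
    simp only [indicialRoot] at hsum
    push_cast at hsum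
    field_simp at hsum ⊢
    linear_combination hsum
  · intro hr₁0
    subst hr₁0
    have hsupp : ∀ s ∉ ({0, r₂, -r₂} : Finset ℤ),
        indicialRoot M s * a 0 s = 0 := fun s hs => by
      by_contra hne0
      apply hs
      have := (hiff s).mp (right_ne_zero_of_mul hne0)
      simp only [Finset.mem_insert, Finset.mem_singleton]
      rcases abs_cases s with ⟨e, -⟩ | ⟨e, -⟩ <;> omega
    rw [tsum_eq_sum hsupp, Finset.sum_insert (by simp; omega), Finset.sum_pair (by omega),
      heven] at hsum
    simp only [indicialRoot] at hsum
    push_cast at hsum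
    field_simp at hsum ⊢
    linear_combination -hsum
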